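/- Let $T_1,\dots,T_d$ be locally finite rooted trees (finite or infinite). View each $T_i$ as a poset in which $v\preccurlyeq w$ means that $v$ lies on the path from $w$ to the root (so the root is the smallest element), and let $d_i(v)$ denote the graph distance in $T_i$ from $v$ to the root. Equip $\mathcal P=T_1\times\dots\times T_d$ with the product order, and let $\Omega\subseteq\mathcal P$ be a finite lower order ideal. Let $g:\mathbb N^d\to\mathbb R_{\ge 0}$ be any function, where $\mathbb N=\{0,1,2,\dots\}$. For $\mathbf m=(m_1,\dots,m_d)\in\mathbb N^d$ and $\mathbf v=(v_1,\dots,v_d)$, $\mathbf w=(w_1,\dots,w_d)$ in $\Omega$, write $\mathbf v\to_{\mathbf m}\mathbf w$ if $v_i\preccurlyeq w_i$ and $d_i(w_i)-d_i(v_i)=m_i$ for all $i$. For $\mathbf v\in\Omega$ define the hook and anti-hook numbers $$H(\mathbf v)=\sum_{\mathbf m\in\mathbb N^d} g(\mathbf m)\,\bigl|\{\mathbf w\in\Omega:\mathbf v\to_{\mathbf m}\mathbf w\}\bigr|,\qquad H^*(\mathbf v)=\sum_{\mathbf m\in\mathbb N^d} g(\mathbf m)\,\bigl|\{\mathbf w\in\Omega:\mathbf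 w\to_{\mathbf m}\mathbf v\}\bigr|.$$ Then the multiset $\{H(\mathbf v):\mathbf v\in\Omega\}$ majorizes the multiset $\{H^*(\mathbf v):\mathbf v\in\Omega\}$. That is, if $n=|\Omega|$ and $a_1\ge\dots\ge a_n$ and $b_1\ge\dots\ge b_n$ are the non-increasing orderings of these two multisets, then $a_1+\dots+a_k\ge b_1+\dots+b_k$ for all $1\le k<n$, and $a_1+\dots+a_n=b_1+\dots+b_n$. -/

import Mathlib

namespace HookMajor

universe u

/-- The underlying graph of a rooted tree: every vertex is joined to its parent and to its
children, that is, the Hasse diagram of the ancestor order (in which the root is `⊥`). -/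
abbrev treeGraph (T : RootedTree.{u}) : SimpleGraph T :=
  SimpleGraph.hasse T

/-- Every vertex has finitely many neighbours. -/
def IsLocallyFinite (T : RootedTree.{u}) : Prop :=
  ∀ v : T, ((treeGraph T).neighborSet v).Finite

/-- The distance from a vertex to the root. -/
noncomputable def rootDist {T : RootedTree.{u}} (v : T) : ℕ :=
  (treeGraph T).dist ⊥ v

/-- `IsShift m v w`: in a product of rooted trees, `v ≤ w` coordinatewise
and `d(w_i) - d(v_i) = m_i` for all `i`. -/
def IsShift {d : ℕ} {T : Fin d → RootedTree.{u}} (m : Fin d → ℕ) (v w : ∀ i, T i) : Prop :=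
  ∀ i, v i ≤ w i ∧ (rootDist (w i) : ℤ) - (rootDist (v i) : ℤ) = (m i : ℤ)

/-- For given `v`, `w` there is at most one shift. -/
theorem IsShift.unique {d : ℕ} {T : Fin d → RootedTree.{u}} {m m' : Fin d → ℕ}
    {v w : ∀ i, T i} (h : IsShift m v w) (h' : IsShift m' v w) : m = m' := by
  funext i
  have h1 := (h i).2
  have h2 := (h' i).2
  omega

open Classical in
/-- The weighted hook number `H(v)`. The outer sum has only finitely many nonzero terms,
as the finite set `Ω` admits only finitely many shifts. -/
noncomputable def hook {d : ℕ} {T : Fin d → RootedTree.{u}} (Ω : Finset (∀ i, T i))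
    (g : (Fin d → ℕ) → ℝ) (v : ∀ i, T i) : ℝ :=
  ∑ᶠ m : Fin d → ℕ, g m * ∑ w ∈ Ω, if IsShift m v w then (1 : ℝ) else 0

open Classical in
/-- The weighted anti-hook number `H*(v)`. -/
noncomputable def antiHook {d : ℕ} {T : Fin d → RootedTree.{u}} (Ω : Finset (∀ i, T i))
    (g : (Fin d → ℕ) → ℝ) (v : ∀ i, T i) : ℝ :=
  ∑ᶠ m : Fin d → ℕ, g m * ∑ w ∈ Ω, if IsShift m w v then (1 : ℝ) else 0

/-- The sum of the first `k` entries of the non-increasing ordering of a multiset. -/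
noncomputable def topSum (A : Multiset ℝ) (k : ℕ) : ℝ :=
  ((A.sort (fun x y => x ≥ y)).take k).sum

/-- Majorization of multisets of real numbers of the same size. -/
def Majorizes (A B : Multiset ℝ) : Prop :=
  A.card = B.card ∧
    (∀ k : ℕ, 1 ≤ k → k < A.card → topSum B k ≤ topSum A k) ∧
    A.sum = B.sum

end HookMajor

namespace HookMajor

universe u

/-! ### Depth and ancestors in a rooted tree. -/

section Tree

variable {T : RootedTree.{u}}

/-! It suffices to find, for each `A ⊆ Ω`, a set `B ⊆ Ω` of the same size whose hook sum is at least
the anti-hook sum of `A`; taking `A` to be the `k` largest anti-hooks then gives majorization. Both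
sums are linear in `g ≥ 0`, so it is enough to compare the numbers of pairs for each shift `m`, with
one `B` serving all `m`.

Since ancestors are unique, an anti-hook pair at `v` only records that each `v i` has depth at least
`m i`. `MixedShift` interpolates between this condition (`S = ∅`) and hook pairs (`S = univ`), and
coordinates are converted one at a time. To convert coordinate `j`, `A` is compressed towards the
root in direction `j`, and `exists_mixedPairs_le_insert` injects the old pairs into the new ones. -/

theorem eq_pred_of_covBy {a b : T} (h : a ⋖ b) : a = Order.pred b := by
  have hb : ¬ IsMin b := fun hm => hm.not_lt h.lt
  rcases (Order.le_pred_of_lt h.lt).lt_or_eq with h1 | h1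
  · exact absurd (Order.pred_lt_of_not_isMin hb) (h.2 h1)
  · exact h1

/-- The number of steps of the predecessor function from a vertex down to the root. -/
theorem exists_depth (T : RootedTree.{u}) :
    ∃ f : T → ℕ, f ⊥ = 0 ∧ ∀ v, v ≠ ⊥ → f v = f (Order.pred v) + 1 := by
  classical
  have key : ∀ v : T, ∃ n, Order.pred^[n] v = ⊥ := fun v => (bot_le (a := v)).exists_pred_iterate
  refine ⟨fun v => Nat.find (key v), by simp, fun v hv => ?_⟩
  rw [Nat.find_eq_iff]
  refine ⟨by simpa [Function.iterate_succ_apply] using Nat.find_spec (key (Order.pred v)), ?_⟩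
  rintro (_ | n) hn
  · simpa using hv
  · rw [Function.iterate_succ_apply]
    exact Nat.find_min (key (Order.pred v)) (Nat.lt_of_succ_lt_succ hn)

/-- The number of parent steps changes by one along each edge, so it bounds the length of every walk
from the root, and the chain of parents attains the bound. -/
theorem rootDist_pred {v : T} (hv : v ≠ ⊥) : rootDist v = rootDist (Order.pred v) + 1 := by
  obtain ⟨f, hf0, hf⟩ := exists_depth T
  suffices h : ∀ v : T, rootDist v = f v by rw [h, h, hf v hv]
  have hcov : ∀ a b : T, a ⋖ b → f b = f a + 1 := by
    intro a b hab
    rw [hf b (ne_bot_of_gt hab.lt), eq_pred_of_covBy hab]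
  have hwalk : ∀ (a b : T) (p : (treeGraph T).Walk a b), f b ≤ f a + p.length := by
    intro a b p
    induction p with
    | nil => simp
    | cons h p ih =>
      rw [SimpleGraph.Walk.length_cons]
      rcases SimpleGraph.hasse_adj.1 h with h | h <;> have := hcov _ _ h <;> omega
  have hup : ∀ n (v : T), f v = n → ∃ p : (treeGraph T).Walk ⊥ v, p.length = n := by
    intro n
    induction n with
    | zero =>
      intro v hv
      by_cases h : v = ⊥
      · subst h; exact ⟨.nil, rfl⟩
      · have := hf v h; omega
    | succ n ih =>
      intro v hv
      have h : v ≠ ⊥ := by rintro rfl; omega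
      obtain ⟨p, hp⟩ := ih (Order.pred v) (by have := hf v h; omega)
      have hadj : (treeGraph T).Adj (Order.pred v) v :=
        SimpleGraph.hasse_adj.2 (Or.inl (Order.pred_covBy_of_not_isMin (by simpa using h)))
      exact ⟨p.concat hadj, by simp [hp]⟩
  intro v
  obtain ⟨p, hp⟩ := hup _ v rfl
  obtain ⟨q, hq⟩ := p.reachable.exists_walk_length_eq_dist
  have h1 := hwalk _ _ q
  have h2 := SimpleGraph.dist_le p
  unfold rootDist
  omega

theorem rootDist_strictMono : StrictMono (rootDist : T → ℕ) := by
  refine strictMono_of_pred_lt fun a ha => ?_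
  have := rootDist_pred (v := a) (by simpa using ha)
  omega

theorem exists_le_rootDist_add {v : T} {n : ℕ} (h : n ≤ rootDist v) :
    ∃ w ≤ v, rootDist v = rootDist w + n := by
  induction n with
  | zero => exact ⟨v, le_rfl, rfl⟩
  | succ n ih =>
    obtain ⟨w, hw, e⟩ := ih (by omega)
    have hb : w ≠ ⊥ := by
      rintro rfl
      simp only [rootDist, SimpleGraph.dist_self] at *
      omega
    have := rootDist_pred hb
    exact ⟨Order.pred w, (Order.pred_le w).trans hw, by omega⟩

/-- The ancestors of `c` form a chain, on which depth is strictly increasing. -/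
theorem le_of_rootDist_le {a b c : T} (ha : a ≤ c) (hb : b ≤ c)
    (h : rootDist a ≤ rootDist b) : a ≤ b := by
  rcases lt_or_le_of_directed hb ha with h1 | h1
  · exact absurd (rootDist_strictMono h1) (by omega)
  · exact h1

end Tree

/-! ### Compression and exchange of one coordinate. -/

section Product

variable {d : ℕ} {T : Fin d → RootedTree.{u}}

/-- `MixedShift S m v w`: in the coordinates of `S`, the vertex `w i` lies `m i` steps above `v i`;
in the others, `w i` equals `v i` and has an ancestor `m i` steps below. -/
def MixedShift (S : Finset (Fin d)) (m : Fin d → ℕ) (v w : ∀ i, T i) : Prop :=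
  (∀ i ∈ S, v i ≤ w i ∧ rootDist (w i) = rootDist (v i) + m i) ∧
    ∀ i ∉ S, w i = v i ∧ m i ≤ rootDist (v i)

open Classical in
/-- The pairs `(v, w) ∈ A × Ω` in the relation `MixedShift S m`. -/
noncomputable def mixedPairs (Ω : Finset (∀ i, T i)) (S : Finset (Fin d)) (m : Fin d → ℕ)
    (A : Finset (∀ i, T i)) : Finset ((∀ i, T i) × (∀ i, T i)) :=
  {p ∈ A ×ˢ Ω | MixedShift S m p.1 p.2}

theorem mem_mixedPairs {Ω A : Finset (∀ i, T i)} {S : Finset (Fin d)} {m : Fin d → ℕ}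
    {p : (∀ i, T i) × (∀ i, T i)} :
    p ∈ mixedPairs Ω S m A ↔ (p.1 ∈ A ∧ p.2 ∈ Ω) ∧ MixedShift S m p.1 p.2 := by
  simp [mixedPairs]

/-- Among injective maps that only move points of `A` towards the root in coordinate `j`, one of
least total depth has an image closed downwards in that coordinate: a gap below some `φ v` could be
filled by moving `φ v` into it. -/
theorem exists_compression (j : Fin d) (A : Finset (∀ i, T i)) :
    ∃ φ : (∀ i, T i) → (∀ i, T i), Set.InjOn φ A ∧
      (∀ v ∈ A, φ v j ≤ v j ∧ ∀ i, i ≠ j → φ v i = v i) ∧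
      ∀ v ∈ A, ∀ t ≤ φ v j, ∃ u ∈ A, φ u = Function.update (φ v) j t := by
  classical
  obtain ⟨φ, ⟨hinj, hle⟩, hmin⟩ := exists_minimalFor_of_wellFoundedLT
    (fun φ : (∀ i, T i) → (∀ i, T i) => Set.InjOn φ A ∧
      ∀ v ∈ A, φ v j ≤ v j ∧ ∀ i, i ≠ j → φ v i = v i)
    (fun φ => ∑ v ∈ A, rootDist (φ v j))
    ⟨id, Function.injective_id.injOn, fun v _ => ⟨le_rfl, fun _ _ => rfl⟩⟩
  refine ⟨φ, hinj, hle, fun v hv t ht => ?_⟩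
  by_contra! hno
  have htlt : t < φ v j := lt_of_le_of_ne ht fun h => hno v hv (by simp [h])
  let ψ : (∀ i, T i) → (∀ i, T i) := Function.update φ v (Function.update (φ v) j t)
  have hψv : ψ v = Function.update (φ v) j t := by simp [ψ]
  have hψ : ∀ u, u ≠ v → ψ u = φ u := fun u hu => by simp [ψ, hu]
  have hlt : ∑ u ∈ A, rootDist (ψ u j) < ∑ u ∈ A, rootDist (φ u j) := by
    have hd : rootDist (ψ v j) < rootDist (φ v j) := by
      rw [hψv, Function.update_self]
      exact rootDist_strictMono htlt
    refine Finset.sum_lt_sum (fun u hu => ?_) ⟨v, hv, hd⟩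
    by_cases h : u = v
    · subst h; exact hd.le
    · rw [hψ u h]
  refine absurd (hmin (j := ψ) ⟨fun a ha b hb hab => ?_, fun u hu => ?_⟩ hlt.le) (not_le.2 hlt)
  · by_cases h1 : a = v <;> by_cases h2 : b = v
    · rw [h1, h2]
    · rw [h1, hψv, hψ b h2] at hab
      exact absurd hab.symm (hno b hb)
    · rw [h2, hψv, hψ a h1] at hab
      exact absurd hab (hno a ha)
    · rw [hψ a h1, hψ b h2] at hab
      exact hinj ha hb hab
  · by_cases h : u = v
    · subst h
      rw [hψv]
      refine ⟨?_, fun i hi => ?_⟩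
      · rw [Function.update_self]; exact ht.trans (hle u hu).1
      · rw [Function.update_of_ne hi]; exact (hle u hu).2 i hi
    · rw [hψ u h]; exact hle u hu

theorem MixedShift.insert {S : Finset (Fin d)} {m : Fin d → ℕ} {v w v' w' : ∀ i, T i} {j : Fin d}
    (h : MixedShift S m v w) (hv : ∀ i, i ≠ j → v' i = v i) (hw : ∀ i, i ≠ j → w' i = w i)
    (hj : v' j ≤ w' j ∧ rootDist (w' j) = rootDist (v' j) + m j) :
    MixedShift (insert j S) m v' w' := by
  refine ⟨fun i hi => ?_, fun i hi => ?_⟩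
  · by_cases e : i = j
    · subst e; exact hj
    · rw [hv i e, hw i e]
      exact h.1 i ((Finset.mem_insert.1 hi).resolve_left e)
  · rw [Finset.mem_insert, not_or] at hi
    rw [hv i hi.1, hw i hi.1]
    exact h.2 i hi.2

/-- The set `B` is the compression of `A` in direction `j`, so it does not depend on `m`. A pair
`(v, w)` with `v j = w j` has two candidate images: lower `v j` by `m j` steps, or replace `v` by `φ
v` and put in coordinate `j` of `w` a vertex `m j` steps above `φ v j`. The predicate `Bad` decides
which to use. -/
theorem exists_mixedPairs_le_insert {Ω : Finset (∀ i, T i)}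
    (hΩ : IsLowerSet (Ω : Set (∀ i, T i))) {S : Finset (Fin d)} {j : Fin d} (hj : j ∉ S)
    {A : Finset (∀ i, T i)} (hA : A ⊆ Ω) :
    ∃ B ⊆ Ω, B.card = A.card ∧
      ∀ m, (mixedPairs Ω S m A).card ≤ (mixedPairs Ω (insert j S) m B).card := by
  classical
  obtain ⟨φ, hinj, hφ, hdown⟩ := exists_compression j A
  refine ⟨A.image φ, ?_, Finset.card_image_of_injOn hinj, fun m => ?_⟩
  · intro x hx
    obtain ⟨v, hv, rfl⟩ := Finset.mem_image.1 hx
    refine hΩ (fun i => ?_) (hA hv)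
    by_cases e : i = j
    · subst e; exact (hφ v hv).1
    · exact ((hφ v hv).2 i e).le
  -- All `t` above `w j` are tested, not just `w j` itself, so that badness passes from `w` to any
  -- `w'` with a lower `j`-coordinate on the path to `t`; this keeps the images of the two cases
  -- disjoint.
  let Bad : (∀ i, T i) → (∀ i, T i) → T j → Prop := fun v w t =>
    w j ≤ t ∧ Function.update w j t ∈ Ω ∧
      ∃ c ≤ t, rootDist t = rootDist c + m j ∧ Function.update v j c ∉ A.image φ
  let r : (∀ i, T i) × (∀ i, T i) → (∀ i, T i) × (∀ i, T i) → Prop := fun p q =>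
    (∃ t, Bad p.1 p.2 t ∧ ∃ s ≤ t, q = (φ p.1, Function.update p.2 j s)) ∨
      (¬ (∃ t, Bad p.1 p.2 t) ∧ ∃ c, q = (Function.update p.1 j c, p.2))
  refine Finset.card_le_card_of_forall_subsingleton r ?_ ?_
  · rintro ⟨v, w⟩ hp
    simp only [mem_mixedPairs] at hp
    obtain ⟨⟨hv, hw⟩, hs⟩ := hp
    obtain ⟨hwv, hm⟩ := hs.2 j hj
    by_cases hbad : ∃ t, Bad v w t
    · obtain ⟨t, hbt⟩ := hbad
      obtain ⟨hwt, htΩ, c, hct, hdc, hcB⟩ := id hbt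
      have hbt' : φ v j ≤ t := (hφ v hv).1.trans (hwv ▸ hwt)
      -- Both `c` and `φ v j` are ancestors of `t`; if `c` were the lower one, downward closure of
      -- the image would put it in `B`.
      have hbc : rootDist (φ v j) < rootDist c := by
        by_contra! hle
        obtain ⟨u, hu, hue⟩ := hdown v hv c (le_of_rootDist_le hct hbt' hle)
        refine hcB (Finset.mem_image.2 ⟨u, hu, hue.trans ?_⟩)
        funext i
        by_cases e : i = j
        · subst e; simp
        · simp [e, (hφ v hv).2 i e]
      -- The ancestor of `t` at depth `rootDist (φ v j) + m j`. By `hbc` this depth is less than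
      -- that of `t`, so the subtraction is not truncated.
      obtain ⟨s, hst, hds⟩ := exists_le_rootDist_add
        (v := t) (n := rootDist t - (rootDist (φ v j) + m j)) (by omega)
      refine ⟨(φ v, Function.update w j s), ?_, Or.inl ⟨t, hbt, s, hst, rfl⟩⟩
      simp only [mem_mixedPairs]
      refine ⟨⟨Finset.mem_image_of_mem _ hv, ?_⟩, ?_⟩
      · exact hΩ (update_le_update_iff.2 ⟨hst, fun _ _ => le_rfl⟩) htΩ
      · refine hs.insert (hφ v hv).2 (fun i hi => Function.update_of_ne hi _ _) ?_
        rw [Function.update_self]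
        exact ⟨le_of_rootDist_le hbt' hst (by omega), by omega⟩
    · obtain ⟨c, hc, hdc⟩ := exists_le_rootDist_add hm
      refine ⟨(Function.update v j c, w), ?_, Or.inr ⟨hbad, c, rfl⟩⟩
      simp only [mem_mixedPairs]
      refine ⟨⟨?_, hw⟩, ?_⟩
      · by_contra hcB
        exact hbad ⟨w j, le_rfl, by simpa using hw, c, hwv ▸ hc, hwv ▸ hdc, hcB⟩
      · refine hs.insert (fun i hi => Function.update_of_ne hi _ _) (fun _ _ => rfl) ?_
        rw [Function.update_self, hwv]
        exact ⟨hc, hdc⟩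
  · have eq_of_update : ∀ {x y : ∀ i, T i} {a b : T j},
        Function.update x j a = Function.update y j b → ∀ i, i ≠ j → x i = y i := by
      intro x y a b h i hi
      simpa [hi] using congrFun h i
    -- If both cases gave the same `q`, the vertex `t` bad for `(v, w)` would be bad for `(v', w')`:
    -- the pairs agree off `j`, and `w' j = s ≤ t`.
    have cross : ∀ (v w v' w' : ∀ i, T i) (q), v ∈ A →
        (∃ t, Bad v w t ∧ ∃ s ≤ t, q = (φ v, Function.update w j s)) →
        (¬ (∃ t, Bad v' w' t) ∧ ∃ c, q = (Function.update v' j c, w')) → False := by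
      rintro v w v' w' q hv ⟨t, ⟨-, htΩ, c, hct, hdc, hcB⟩, s, hst, rfl⟩ ⟨hbad, c', hq⟩
      rw [Prod.mk.injEq] at hq
      obtain ⟨h1, rfl⟩ := hq
      refine hbad ⟨t, by simpa using hst, by simpa using htΩ, c, hct, hdc, ?_⟩
      convert hcB using 2
      funext i
      by_cases e : i = j
      · subst e; simp
      · have := congrFun h1 i
        simp only [Function.update_of_ne e] at this ⊢
        rw [← this, (hφ v hv).2 i e]
    rintro q - ⟨v, w⟩ ⟨hp, h⟩ ⟨v', w'⟩ ⟨hp', h'⟩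
    simp only [mem_mixedPairs] at hp hp'
    have e1 := (hp.2.2 j hj).1
    have e2 := (hp'.2.2 j hj).1
    rcases h with h | h <;> rcases h' with h' | h'
    · obtain ⟨t, -, s, -, rfl⟩ := h
      obtain ⟨t', -, s', -, hq⟩ := h'
      simp only [Prod.mk.injEq] at hq
      -- The overwritten coordinate `w j` is recovered from `v j`, as the two are equal.
      have hvv : v = v' := hinj hp.1.1 hp'.1.1 hq.1
      subst hvv
      refine Prod.ext rfl (funext fun i => ?_)
      by_cases e : i = j
      · subst e; exact e1.trans e2.symm
      · exact eq_of_update hq.2 i e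
    · exact (cross v w v' w' q hp.1.1 h h').elim
    · exact (cross v' w' v w q hp'.1.1 h' h).elim
    · obtain ⟨-, c, rfl⟩ := h
      obtain ⟨-, c', hq⟩ := h'
      simp only [Prod.mk.injEq] at hq
      obtain ⟨hq, hww⟩ := hq
      subst hww
      refine Prod.ext (funext fun i => ?_) rfl
      by_cases e : i = j
      · subst e; exact e1.symm.trans e2
      · exact eq_of_update hq i e

theorem exists_mixedPairs_le {Ω : Finset (∀ i, T i)} (hΩ : IsLowerSet (Ω : Set (∀ i, T i)))
    {A : Finset (∀ i, T i)} (hA : A ⊆ Ω) (S : Finset (Fin d)) :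
    ∃ B ⊆ Ω, B.card = A.card ∧
      ∀ m, (mixedPairs Ω ∅ m A).card ≤ (mixedPairs Ω S m B).card := by
  classical
  induction S using Finset.induction_on with
  | empty => exact ⟨A, hA, rfl, fun _ => le_rfl⟩
  | insert j S hj ih =>
    obtain ⟨B, hB, hc, h⟩ := ih
    obtain ⟨C, hC, hc', h'⟩ := exists_mixedPairs_le_insert hΩ hj hB
    exact ⟨C, hC, hc'.trans hc, fun m => (h m).trans (h' m)⟩

theorem isShift_iff_mixedShift_univ {m : Fin d → ℕ} {v w : ∀ i, T i} :
    IsShift m v w ↔ MixedShift Finset.univ m v w := by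
  simp only [IsShift, MixedShift, Finset.mem_univ, true_imp_iff, not_true, false_imp_iff,
    implies_true, and_true]
  refine forall_congr' fun i => and_congr_right fun _ => ?_
  omega

-- The vertex `m i` steps below `v i` exists exactly when `v i` has depth at least `m i`, and is
-- then unique; it lies in `Ω` because `Ω` is a lower set.
open Classical in
theorem card_shift_eq_mixedPairs_empty {Ω : Finset (∀ i, T i)}
    (hΩ : IsLowerSet (Ω : Set (∀ i, T i))) {A : Finset (∀ i, T i)} (hA : A ⊆ Ω) (m : Fin d → ℕ) :
    ({p ∈ A ×ˢ Ω | IsShift m p.2 p.1} : Finset _).card = (mixedPairs Ω ∅ m A).card := by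
  -- The `else` value is never reached on the pairs considered.
  refine Finset.card_nbij' (fun p => (p.1, p.1)) (fun p => (p.1, fun i =>
    if h : m i ≤ rootDist (p.1 i) then (exists_le_rootDist_add h).choose else p.1 i)) ?_ ?_ ?_ ?_
  · rintro ⟨v, w⟩ h
    simp only [Finset.mem_coe, mem_mixedPairs, MixedShift, Finset.mem_filter,
      Finset.mem_product] at h ⊢
    refine ⟨⟨h.1.1, hA h.1.1⟩, by simp, fun i _ => ⟨trivial, ?_⟩⟩
    have := (h.2 i).2
    omega
  · rintro ⟨v, w⟩ h
    simp only [Finset.mem_coe, mem_mixedPairs, MixedShift, Finset.mem_filter,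
      Finset.mem_product] at h ⊢
    have hm : ∀ i, m i ≤ rootDist (v i) := fun i => (h.2.2 i (by simp)).2
    refine ⟨⟨h.1.1, hΩ (fun i => ?_) (hA h.1.1)⟩, fun i => ?_⟩
    · simp only [hm i, dif_pos]
      exact (exists_le_rootDist_add (hm i)).choose_spec.1
    · simp only [hm i, dif_pos]
      have := (exists_le_rootDist_add (hm i)).choose_spec
      exact ⟨this.1, by omega⟩
  · rintro ⟨v, w⟩ h
    simp only [Finset.mem_coe, Finset.mem_filter, Finset.mem_product] at h
    refine Prod.ext rfl (funext fun i => ?_)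
    have hs := h.2 i
    have hm : m i ≤ rootDist (v i) := by omega
    have hc := (exists_le_rootDist_add hm).choose_spec
    simp only [hm, dif_pos]
    exact le_antisymm (le_of_rootDist_le hc.1 hs.1 (by omega))
      (le_of_rootDist_le hs.1 hc.1 (by omega))
  · rintro ⟨v, w⟩ h
    simp only [Finset.mem_coe, mem_mixedPairs, MixedShift] at h
    exact Prod.ext rfl (funext fun i => (h.2.2 i (by simp)).1.symm)

/-! ### Hook and anti-hook sums as weighted pair counts. -/

open Classical in
/-- A finite set containing all shifts between elements of `Ω`. -/
noncomputable def shifts (Ω : Finset (∀ i, T i)) : Finset (Fin d → ℕ) :=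
  (Ω ×ˢ Ω).image fun p i => rootDist (p.2 i) - rootDist (p.1 i)

theorem IsShift.mem_shifts {Ω : Finset (∀ i, T i)} {m : Fin d → ℕ} {v w : ∀ i, T i}
    (h : IsShift m v w) (hv : v ∈ Ω) (hw : w ∈ Ω) : m ∈ shifts Ω := by
  refine Finset.mem_image.2 ⟨(v, w), Finset.mem_product.2 ⟨hv, hw⟩, funext fun i => ?_⟩
  have := (h i).2
  simp only
  omega

open Classical in
theorem hook_eq_sum {Ω : Finset (∀ i, T i)} (g : (Fin d → ℕ) → ℝ) {v : ∀ i, T i} (hv : v ∈ Ω) :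
    hook Ω g v = ∑ m ∈ shifts Ω, g m * ∑ w ∈ Ω, if IsShift m v w then (1 : ℝ) else 0 := by
  refine finsum_eq_sum_of_support_subset _ fun m hm => ?_
  obtain ⟨w, hw, h⟩ := Finset.exists_ne_zero_of_sum_ne_zero (right_ne_zero_of_mul hm)
  exact IsShift.mem_shifts (of_not_not fun hn => h (if_neg hn)) hv hw

open Classical in
theorem antiHook_eq_sum {Ω : Finset (∀ i, T i)} (g : (Fin d → ℕ) → ℝ) {v : ∀ i, T i}
    (hv : v ∈ Ω) :
    antiHook Ω g v = ∑ m ∈ shifts Ω, g m * ∑ w ∈ Ω, if IsShift m w v then (1 : ℝ) else 0 := by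
  refine finsum_eq_sum_of_support_subset _ fun m hm => ?_
  obtain ⟨w, hw, h⟩ := Finset.exists_ne_zero_of_sum_ne_zero (right_ne_zero_of_mul hm)
  exact IsShift.mem_shifts (of_not_not fun hn => h (if_neg hn)) hw hv

open Classical in
theorem sum_hook {Ω A : Finset (∀ i, T i)} (g : (Fin d → ℕ) → ℝ) (hA : A ⊆ Ω) :
    ∑ v ∈ A, hook Ω g v =
      ∑ m ∈ shifts Ω, g m * (({p ∈ A ×ˢ Ω | IsShift m p.1 p.2} : Finset _).card : ℝ) := by
  rw [Finset.sum_congr rfl fun v hv => hook_eq_sum g (hA hv), Finset.sum_comm]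
  refine Finset.sum_congr rfl fun m _ => ?_
  rw [← Finset.mul_sum, ← Finset.sum_boole, Finset.sum_product]

open Classical in
theorem sum_antiHook {Ω A : Finset (∀ i, T i)} (g : (Fin d → ℕ) → ℝ) (hA : A ⊆ Ω) :
    ∑ v ∈ A, antiHook Ω g v =
      ∑ m ∈ shifts Ω, g m * (({p ∈ A ×ˢ Ω | IsShift m p.2 p.1} : Finset _).card : ℝ) := by
  rw [Finset.sum_congr rfl fun v hv => antiHook_eq_sum g (hA hv), Finset.sum_comm]
  refine Finset.sum_congr rfl fun m _ => ?_
  rw [← Finset.mul_sum, ← Finset.sum_boole, Finset.sum_product]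

theorem sum_hook_eq_sum_antiHook (Ω : Finset (∀ i, T i)) (g : (Fin d → ℕ) → ℝ) :
    ∑ v ∈ Ω, hook Ω g v = ∑ v ∈ Ω, antiHook Ω g v := by
  classical
  rw [Finset.sum_congr rfl fun v hv => hook_eq_sum g hv,
    Finset.sum_congr rfl fun v hv => antiHook_eq_sum g hv, Finset.sum_comm,
    Finset.sum_comm (s := Ω)]
  refine Finset.sum_congr rfl fun m _ => ?_
  rw [← Finset.mul_sum, ← Finset.mul_sum, Finset.sum_comm]

theorem exists_sum_antiHook_le_sum_hook {Ω A : Finset (∀ i, T i)}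
    (hΩ : IsLowerSet (Ω : Set (∀ i, T i))) {g : (Fin d → ℕ) → ℝ} (hg : ∀ m, 0 ≤ g m)
    (hA : A ⊆ Ω) :
    ∃ B ⊆ Ω, B.card = A.card ∧ ∑ v ∈ A, antiHook Ω g v ≤ ∑ v ∈ B, hook Ω g v := by
  classical
  obtain ⟨B, hB, hc, h⟩ := exists_mixedPairs_le hΩ hA Finset.univ
  refine ⟨B, hB, hc, ?_⟩
  rw [sum_hook g hB, sum_antiHook g hA]
  refine Finset.sum_le_sum fun m _ => mul_le_mul_of_nonneg_left ?_ (hg m)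
  rw [card_shift_eq_mixedPairs_empty hΩ hA]
  simp only [isShift_iff_mixedShift_univ]
  exact_mod_cast h m

end Product

/-! ### Sums of the largest values. -/

section TopSum

variable {α : Type*}

/-- The sum of the `k` largest values of `f` on `s` is attained on a subset that dominates its
complement. -/
theorem exists_topSum_eq (s : Finset α) (f : α → ℝ) {k : ℕ} (hk : k ≤ s.card) :
    ∃ A ⊆ s, A.card = k ∧ topSum (s.val.map f) k = ∑ a ∈ A, f a ∧
      ∀ a ∈ A, ∀ b ∈ s, b ∉ A → f b ≤ f a := by
  classical
  -- Sorting the elements by `f`, rather than the values, keeps track of which elements realise the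
  -- top sum.
  obtain ⟨l, hl, hp, hs⟩ : ∃ l : List α, l.Perm s.toList ∧ l.Pairwise (fun a b => f a ≥ f b) ∧
      (s.val.map f).sort (fun x y => x ≥ y) = l.map f := by
    refine ⟨s.toList.mergeSort (fun a b => decide (f a ≥ f b)), List.mergeSort_perm _ _, ?_, ?_⟩
    · have := List.pairwise_mergeSort (le := fun a b => decide (f a ≥ f b))
        (fun a b c h1 h2 => by simp only [decide_eq_true_eq] at *; exact h2.trans h1)
        (fun a b => by simpa using le_total (f b) (f a)) s.toList
      simpa using this
    · rw [← Finset.coe_toList s, Multiset.map_coe, Multiset.coe_sort]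
      exact (List.map_mergeSort (by simp)).symm
  have hnd : l.Nodup := hl.nodup_iff.2 s.nodup_toList
  have hmem : ∀ a, a ∈ l ↔ a ∈ s := fun a => by rw [hl.mem_iff, Finset.mem_toList]
  have hlen : l.length = s.card := by rw [hl.length_eq, Finset.length_toList]
  have hndk : (l.take k).Nodup := hnd.sublist (List.take_sublist k l)
  refine ⟨(l.take k).toFinset, fun a ha => ?_, ?_, ?_, fun a ha b hb hbA => ?_⟩
  · exact (hmem a).1 (List.mem_of_mem_take (List.mem_toFinset.1 ha))
  · rw [List.toFinset_card_of_nodup hndk, List.length_take]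
    omega
  · rw [topSum, hs, ← List.map_take, List.sum_toFinset f hndk]
  · rw [List.mem_toFinset] at ha hbA
    have hb' := (hmem b).2 hb
    rw [← List.take_append_drop k l] at hb' hp
    exact (List.pairwise_append.1 hp).2.2 a ha b ((List.mem_append.1 hb').resolve_left hbA)

theorem sum_le_topSum {s B : Finset α} (f : α → ℝ) (hB : B ⊆ s) :
    ∑ b ∈ B, f b ≤ topSum (s.val.map f) B.card := by
  classical
  obtain ⟨A, -, hc, he, hdom⟩ := exists_topSum_eq s f (Finset.card_le_card hB)
  -- The differences `B \ A` and `A \ B` have equal size, and the maximum of `f` on the first is at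
  -- most every value on the second.
  rw [he, ← Finset.sum_sdiff_le_sum_sdiff]
  rcases (B \ A).eq_empty_or_nonempty with h | h
  · have hAB : B = A := Finset.eq_of_subset_of_card_le (Finset.sdiff_eq_empty_iff_subset.1 h) hc.le
    simp [hAB]
  · obtain ⟨b, hb, hmax⟩ := Finset.exists_max_image _ f h
    rw [Finset.mem_sdiff] at hb
    have hcard : (B \ A).card = (A \ B).card := Finset.card_sdiff_comm hc.symm
    calc ∑ x ∈ B \ A, f x ≤ (B \ A).card • f b := Finset.sum_le_card_nsmul _ _ _ hmax
      _ = (A \ B).card • f b := by rw [hcard]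
      _ ≤ ∑ x ∈ A \ B, f x := Finset.card_nsmul_le_sum _ _ _ fun a ha =>
          hdom a (Finset.mem_sdiff.1 ha).1 b (hB hb.1) hb.2

end TopSum

end HookMajor

theorem theorem6p1 {d : ℕ} (T : Fin d → RootedTree)
    (hT : ∀ i, HookMajor.IsLocallyFinite (T i))
    (Ω : Finset (∀ i, T i)) (hΩ : IsLowerSet (Ω : Set (∀ i, T i)))
    (g : (Fin d → ℕ) → ℝ) (hg : ∀ m, 0 ≤ g m) :
    HookMajor.Majorizes
      (Ω.val.map (HookMajor.hook Ω g))
      (Ω.val.map (HookMajor.antiHook Ω g)) := by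
  refine ⟨by simp, fun k _ hk => ?_, HookMajor.sum_hook_eq_sum_antiHook Ω g⟩
  rw [Multiset.card_map, Finset.card_val] at hk
  obtain ⟨A, hA, hc, he, -⟩ := HookMajor.exists_topSum_eq Ω (HookMajor.antiHook Ω g) hk.le
  obtain ⟨B, hB, hBc, hle⟩ := HookMajor.exists_sum_antiHook_le_sum_hook hΩ hg hA
  rw [he, ← hc, ← hBc]
  exact hle.trans (HookMajor.sum_le_topSum _ hB)
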